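/- Let $A$ be a unital Kirchberg algebra, that is, a unital, separable, nuclear, simple, purely infinite C*-algebra. Let $p\in A$ be a projection with $p\neq 0$ and $p\neq 1$ whose class $[p]_0$ in $K_0(A)$ vanishes, and put $u=1-2p$. Then for every $\varepsilon>0$ there exist positive contractions $f^{(0)},f^{(1)}\in A$ such that $$ f^{(i)}\cdot\bigl(u f^{(i)}u^*\bigr)=0\quad (i=0,1)\qquad\text{and}\qquad \Bigl\|\sum_{i=0}^{1}\bigl(f^{(i)}+u f^{(i)}u^*\bigr)-1\Bigr\|\le\varepsilon . $$ -/

import Mathlib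

open scoped ComplexOrder CStarAlgebra Matrix

noncomputable section

/-! ### Kirchberg algebras -/

section Kirchberg

variable (A : Type*) [NonUnitalCStarAlgebra A] [PartialOrder A] [StarOrderedRing A]

/-- Nuclearity, as the completely positive approximation property: the identity of `A` is a
point-norm limit of maps `ψ ∘ φ` with `φ : A → M_n(ℂ)` and `ψ : M_n(ℂ) → A` completely positive
contractions. -/
def IsNuclearCStar : Prop :=
  ∀ (F : Finset A) (ε : ℝ), 0 < ε →
    ∃ (n : ℕ) (φ : A →CP CStarMatrix (Fin n) (Fin n) ℂ) (ψ : CStarMatrix (Fin n) (Fin n) ℂ →CP A),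
      (∀ a, ‖φ a‖ ≤ ‖a‖) ∧ (∀ b, ‖ψ b‖ ≤ ‖b‖) ∧ ∀ a ∈ F, ‖ψ (φ a) - a‖ < ε

/-- A C*-algebra is simple if it is nonzero and its only closed two-sided ideals are `0` and
itself. -/
def IsSimpleCStar : Prop :=
  Nontrivial A ∧ ∀ I : TwoSidedIdeal A, IsClosed (I : Set A) → I = ⊥ ∨ I = ⊤

variable {A}

/-- A hereditary C*-subalgebra: a norm-closed star subalgebra `B` such that `0 ≤ a ≤ b` with
`b ∈ B` implies `a ∈ B`. -/
structure IsHereditaryCStarSubalgebra (B : NonUnitalStarSubalgebra ℂ A) : Prop where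
  isClosed : IsClosed (B : Set A)
  mem_of_le : ∀ a b : A, 0 ≤ a → a ≤ b → b ∈ B → a ∈ B

/-- An infinite projection: one that is Murray-von Neumann equivalent to a proper
subprojection of itself. -/
def IsInfiniteProjection (p : A) : Prop :=
  IsStarProjection p ∧ ∃ v : A, star v * v = p ∧ v * star v ≤ p ∧ v * star v ≠ p

variable (A)

/-- A (simple) C*-algebra is purely infinite if every nonzero hereditary C*-subalgebra contains
an infinite projection. -/
def IsPurelyInfiniteCStar : Prop :=
  ∀ B : NonUnitalStarSubalgebra ℂ A, IsHereditaryCStarSubalgebra B → B ≠ ⊥ →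
    ∃ p ∈ B, IsInfiniteProjection p

/-- Kirchberg algebras: separable, nuclear, simple, purely infinite C*-algebras. -/
structure IsKirchbergAlgebra : Prop where
  separable : TopologicalSpace.SeparableSpace A
  nuclear : IsNuclearCStar A
  simple : IsSimpleCStar A
  purelyInfinite : IsPurelyInfiniteCStar A

end Kirchberg

/-! ### The group `K₀` of a unital C*-algebra -/

section KZero

variable {A : Type*} [CStarAlgebra A]

/-- Projections in the star algebra of `m × m` matrices over `A`. -/
def IsMatrixProj {m : Type*} [Fintype m] (p : Matrix m m A) : Prop :=
  p * p = p ∧ pᴴ = p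

/-- Murray-von Neumann equivalence of (projection) matrices of possibly different sizes. -/
def MvNEquiv {m n : Type*} [Fintype m] [Fintype n] (p : Matrix m m A) (q : Matrix n n A) : Prop :=
  ∃ v : Matrix n m A, vᴴ * v = p ∧ v * vᴴ = q

section blocks

variable {k m n : Type*}

/-- The block diagonal sum `p ⊕ q`. -/
def blockSum (p : Matrix m m A) (q : Matrix n n A) : Matrix (m ⊕ n) (m ⊕ n) A :=
  Matrix.fromBlocks p 0 0 q

theorem blockSum_swap (p : Matrix m m A) (q : Matrix n n A) :
    (blockSum p q).submatrix (Equiv.sumComm n m) (Equiv.sumComm n m) = blockSum q p := by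
  ext i j
  rcases i with i | i <;> rcases j with j | j <;> rfl

theorem blockSum_assoc (p : Matrix k k A) (q : Matrix m m A) (r : Matrix n n A) :
    (blockSum p (blockSum q r)).submatrix (Equiv.sumAssoc k m n) (Equiv.sumAssoc k m n) =
      blockSum (blockSum p q) r := by
  ext i j
  rcases i with (i | i) | i <;> rcases j with (j | j) | j <;> rfl

theorem blockSum_empty [IsEmpty n] (p : Matrix m m A) (q : Matrix n n A) :
    (blockSum p q).submatrix (Equiv.sumEmpty m n).symm (Equiv.sumEmpty m n).symm = p := by
  ext i j
  rfl

end blocks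

section lemmas

variable {k l m n : Type*} [Fintype k] [Fintype l] [Fintype m] [Fintype n]

theorem MvNEquiv.refl {p : Matrix m m A} (hp : IsMatrixProj p) : MvNEquiv p p :=
  ⟨p, by rw [hp.2, hp.1], by rw [hp.2, hp.1]⟩

theorem MvNEquiv.symm {p : Matrix m m A} {q : Matrix n n A} (h : MvNEquiv p q) :
    MvNEquiv q p := by
  obtain ⟨v, h1, h2⟩ := h
  exact ⟨vᴴ, by simpa using h2, by simpa using h1⟩

theorem MvNEquiv.trans {p : Matrix l l A} {q : Matrix m m A} {r : Matrix n n A}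
    (hp : IsMatrixProj p) (hr : IsMatrixProj r)
    (h : MvNEquiv p q) (h' : MvNEquiv q r) : MvNEquiv p r := by
  obtain ⟨v, rfl, h2⟩ := h
  obtain ⟨w, h3, rfl⟩ := h'
  refine ⟨w * v, ?_, ?_⟩
  · rw [Matrix.conjTranspose_mul]
    calc vᴴ * wᴴ * (w * v) = vᴴ * (wᴴ * w) * v := by simp only [Matrix.mul_assoc]
      _ = (vᴴ * v) * (vᴴ * v) := by rw [h3, ← h2]; simp only [Matrix.mul_assoc]
      _ = vᴴ * v := hp.1
  · rw [Matrix.conjTranspose_mul]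
    calc w * v * (vᴴ * wᴴ) = w * (v * vᴴ) * wᴴ := by simp only [Matrix.mul_assoc]
      _ = (w * wᴴ) * (w * wᴴ) := by rw [h2, ← h3]; simp only [Matrix.mul_assoc]
      _ = w * wᴴ := hr.1

theorem IsMatrixProj.zero : IsMatrixProj (0 : Matrix m m A) :=
  ⟨by simp, by simp⟩

theorem IsMatrixProj.blockSum {p : Matrix m m A} {q : Matrix n n A} (hp : IsMatrixProj p)
    (hq : IsMatrixProj q) : IsMatrixProj (blockSum p q) := by
  constructor
  · simp [_root_.blockSum, Matrix.fromBlocks_multiply, hp.1, hq.1]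
  · simp [_root_.blockSum, Matrix.fromBlocks_conjTranspose, hp.2, hq.2]

theorem IsMatrixProj.submatrix {p : Matrix m m A} (hp : IsMatrixProj p) (e : n ≃ m) :
    IsMatrixProj (p.submatrix e e) := by
  constructor
  · rw [Matrix.submatrix_mul_equiv, hp.1]
  · rw [Matrix.conjTranspose_submatrix, hp.2]

theorem MvNEquiv.submatrix {p : Matrix m m A} (hp : IsMatrixProj p) (e : n ≃ m) :
    MvNEquiv p (p.submatrix e e) := by
  refine ⟨p.submatrix e id, ?_, ?_⟩
  · rw [Matrix.conjTranspose_submatrix, Matrix.submatrix_mul_equiv, hp.2, hp.1,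
      Matrix.submatrix_id_id]
  · rw [Matrix.conjTranspose_submatrix, hp.2,
      ← Matrix.submatrix_mul p p e id e Function.bijective_id, hp.1]

theorem MvNEquiv.blockSum {p : Matrix k k A} {p' : Matrix l l A} {q : Matrix m m A}
    {q' : Matrix n n A} (h : MvNEquiv p p') (h' : MvNEquiv q q') :
    MvNEquiv (blockSum p q) (blockSum p' q') := by
  obtain ⟨v, rfl, rfl⟩ := h
  obtain ⟨w, rfl, rfl⟩ := h'
  refine ⟨Matrix.fromBlocks v 0 0 w, ?_, ?_⟩ <;>
  simp [_root_.blockSum, Matrix.fromBlocks_multiply, Matrix.fromBlocks_conjTranspose]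

end lemmas

variable (A)

/-- Projections in matrix algebras `M_n(A)`, with `n` arbitrary. -/
structure MatProj where
  size : ℕ
  mat : Matrix (Fin size) (Fin size) A
  isProj : IsMatrixProj mat

variable {A}

/-- A projection matrix indexed by any finite type, with its indices enumerated. -/
def MatProj.ofFintype {m : Type*} [Fintype m] (p : Matrix m m A) (hp : IsMatrixProj p) :
    MatProj A :=
  ⟨Fintype.card m, p.submatrix (Fintype.equivFin m).symm (Fintype.equivFin m).symm,
    hp.submatrix _⟩

theorem MatProj.ofFintype_equiv {m : Type*} [Fintype m] (p : Matrix m m A) (hp : IsMatrixProj p) :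
    MvNEquiv p (MatProj.ofFintype p hp).mat :=
  MvNEquiv.submatrix hp _

variable (A) in
/-- Murray-von Neumann equivalence on projections over matrix algebras. -/
instance MatProj.setoid : Setoid (MatProj A) where
  r p q := MvNEquiv p.mat q.mat
  iseqv :=
    { refl := fun p => MvNEquiv.refl p.isProj
      symm := fun h => h.symm
      trans := fun {p _ r} h h' => h.trans p.isProj r.isProj h' }

variable (A) in
/-- The Murray-von Neumann semigroup `V(A)`. -/
def VMonoid : Type _ := Quotient (MatProj.setoid A)

/-- The class in `V(A)` of a projection matrix over `A`. -/
def VMonoid.mk {m : Type*} [Fintype m] (p : Matrix m m A) (hp : IsMatrixProj p) : VMonoid A :=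
  Quotient.mk (MatProj.setoid A) (MatProj.ofFintype p hp)

theorem VMonoid.mk_eq_mk {m n : Type*} [Fintype m] [Fintype n] {p : Matrix m m A}
    {q : Matrix n n A} (hp : IsMatrixProj p) (hq : IsMatrixProj q) :
    VMonoid.mk p hp = VMonoid.mk q hq ↔ MvNEquiv p q := by
  have h1 := MatProj.ofFintype_equiv p hp
  have h2 := MatProj.ofFintype_equiv q hq
  refine Quotient.eq.trans ⟨fun h => ?_, fun h => ?_⟩
  · exact (h1.trans hp (MatProj.isProj _) h).trans hp hq h2.symm
  · exact (h1.symm.trans (MatProj.isProj _) hq h).trans (MatProj.isProj _) (MatProj.isProj _) h2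

theorem VMonoid.ind {P : VMonoid A → Prop}
    (h : ∀ (n : ℕ) (p : Matrix (Fin n) (Fin n) A) (hp : IsMatrixProj p), P (VMonoid.mk p hp))
    (x : VMonoid A) : P x := by
  induction x using Quotient.inductionOn with
  | h p =>
    have : VMonoid.mk p.mat p.isProj = Quotient.mk (MatProj.setoid A) p :=
      Quotient.sound (MatProj.ofFintype_equiv p.mat p.isProj).symm
    rw [← this]
    exact h _ _ _

instance VMonoid.instZero : Zero (VMonoid A) :=
  ⟨VMonoid.mk (0 : Matrix (Fin 0) (Fin 0) A) IsMatrixProj.zero⟩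

/-- Addition on `V(A)` is induced by the block diagonal sum. -/
instance VMonoid.instAdd : Add (VMonoid A) :=
  ⟨Quotient.lift₂ (fun p q => VMonoid.mk (blockSum p.mat q.mat) (p.isProj.blockSum q.isProj))
    (fun _ _ _ _ h h' => (VMonoid.mk_eq_mk _ _).2 (MvNEquiv.blockSum h h'))⟩

theorem VMonoid.mk_add_mk {m n : Type*} [Fintype m] [Fintype n] {p : Matrix m m A}
    {q : Matrix n n A} (hp : IsMatrixProj p) (hq : IsMatrixProj q) :
    VMonoid.mk p hp + VMonoid.mk q hq = VMonoid.mk (blockSum p q) (hp.blockSum hq) :=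
  (VMonoid.mk_eq_mk _ _).2
    (MvNEquiv.blockSum (MatProj.ofFintype_equiv p hp).symm (MatProj.ofFintype_equiv q hq).symm)

theorem VMonoid.add_comm' (x y : VMonoid A) : x + y = y + x := by
  induction x using VMonoid.ind with | h m p hp =>
  induction y using VMonoid.ind with | h n q hq =>
  rw [VMonoid.mk_add_mk, VMonoid.mk_add_mk, VMonoid.mk_eq_mk, ← blockSum_swap p q]
  exact MvNEquiv.submatrix (hp.blockSum hq) _

theorem VMonoid.add_zero' (x : VMonoid A) : x + 0 = x := by
  induction x using VMonoid.ind with | h m p hp =>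
  change VMonoid.mk p hp + VMonoid.mk (0 : Matrix (Fin 0) (Fin 0) A) IsMatrixProj.zero = _
  rw [VMonoid.mk_add_mk, VMonoid.mk_eq_mk]
  have h := MvNEquiv.submatrix (hp.blockSum (IsMatrixProj.zero (A := A) (m := Fin 0)))
    (Equiv.sumEmpty (Fin m) (Fin 0)).symm
  rwa [blockSum_empty] at h

instance VMonoid.instAddCommMonoid : AddCommMonoid (VMonoid A) where
  add_assoc x y z := by
    induction x using VMonoid.ind with | h l p hp =>
    induction y using VMonoid.ind with | h m q hq =>
    induction z using VMonoid.ind with | h n r hr =>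
    simp only [VMonoid.mk_add_mk]
    rw [VMonoid.mk_eq_mk, ← blockSum_assoc p q r]
    exact (MvNEquiv.submatrix (hp.blockSum (hq.blockSum hr)) _).symm
  zero_add x := by rw [VMonoid.add_comm', VMonoid.add_zero']
  add_zero := VMonoid.add_zero'
  add_comm := VMonoid.add_comm'
  nsmul := nsmulRec

variable (A) in
/-- `K₀(A)` of a unital C*-algebra: the Grothendieck group of `V(A)`. -/
abbrev KZero : Type _ := Algebra.GrothendieckAddGroup (VMonoid A)

/-- The class `[p]₀ ∈ K₀(A)` of a projection `p ∈ A`, regarded as a `1 × 1` matrix. -/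
def kZeroClass (p : A) (hp : IsStarProjection p) : KZero A :=
  Algebra.GrothendieckAddGroup.of
    (VMonoid.mk (Matrix.of fun _ _ : Fin 1 => p)
      ⟨by ext i j; simpa [Matrix.mul_apply] using hp.isIdempotentElem.eq,
        by ext i j; simpa using hp.isSelfAdjoint.star_eq⟩)

end KZero

end

/-!
Write `q = 1 - p`. If `c ≥ 0` lives under `q` and `x` carries the support of `c` isometrically
under `p`, then `f = ½ (1 + x) c (1 + x)⋆` is orthogonal to `u f u⋆ = ½ (1 - x) c (1 - x)⋆` and
the two add up to `c + x c x⋆`. It therefore suffices to approximate the unit by a sum of two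
elements of this form.

Pure infiniteness gives `v` with `v⋆ v = q` and `v v⋆ ≤ p`, and `n` orthogonal copies
`w₀, …, wₙ₋₁` of the defect `r = p - v v⋆` under `q`. Applied to `v` alone, the construction
covers everything but `r`. Instead, the second tower exchanges the ranges of the `wᵢ` with those
of the shifted family `r, v w₀, v w₁, …` under `p`, with weights `1 - (i + 1) / n`, and these
weights are taken off the first tower. The two towers then add up to `1` except for the jumps of
size `1 / n` between consecutive weights, which occur on orthogonal projections.
-/

section PartialIsometry

variable {A : Type*} [NonUnitalNormedRing A] [StarRing A] [CStarRing A] {e s : A}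

theorem mul_eq_self_of_star_mul_self_eq (he : IsStarProjection e) (hs : star s * s = e) :
    s * e = s := by
  rw [← sub_eq_zero, ← CStarRing.star_mul_self_eq_zero_iff]
  calc star (s * e - s) * (s * e - s)
      = e * (star s * s) * e - e * (star s * s) - star s * s * e + star s * s := by
        rw [star_sub, star_mul, he.isSelfAdjoint.star_eq]; noncomm_ring
    _ = 0 := by simp only [hs, he.isIdempotentElem.eq]; abel

theorem isStarProjection_mul_star_self (he : IsStarProjection e) (hs : star s * s = e) :
    IsStarProjection (s * star s) where
  isIdempotentElem := by
    rw [IsIdempotentElem, ← mul_assoc, mul_assoc s, hs, mul_eq_self_of_star_mul_self_eq he hs]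
  isSelfAdjoint := .mul_star_self s

end PartialIsometry

/-- The elements `w i` are partial isometries with mutually orthogonal ranges and the common source
projection `r`; their range projections are thus orthogonal copies of `r`. -/
structure IsOrthogonalCopies {ι A : Type*} [NonUnitalSemiring A] [StarRing A] (r : A) (w : ι → A) :
    Prop where
  isStarProjection : IsStarProjection r
  star_mul_self : ∀ i, star (w i) * w i = r
  star_mul_of_ne : ∀ ⦃i j⦄, i ≠ j → star (w i) * w j = 0

section Transfer

variable {ι A : Type*} [Ring A] [StarRing A] [Algebra ℝ A]

/-- The element `∑ i ∈ s, d i z i w i⋆`, carrying the range of `w i` to that of `z i` with weight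
`d i`. For `d = 1` it is a partial isometry exchanging two families of orthogonal copies; for
`z = w` it is a weighted sum of the range projections. -/
def transfer (s : Finset ι) (d : ι → ℝ) (z w : ι → A) : A :=
  ∑ i ∈ s, d i • (z i * star (w i))

variable {s : Finset ι} {d : ι → ℝ} {x : A} {z w : ι → A}

theorem mul_transfer {y : ι → A} (hx : ∀ i ∈ s, x * z i = y i) :
    x * transfer s d z w = transfer s d y w := by
  rw [transfer, Finset.mul_sum]
  exact Finset.sum_congr rfl fun i hi => by rw [mul_smul_comm, ← mul_assoc, hx i hi]

theorem mul_transfer_eq_zero (hx : ∀ i, x * z i = 0) : x * transfer s d z w = 0 := by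
  rw [mul_transfer fun i _ => hx i]
  simp only [transfer, zero_mul, smul_zero, Finset.sum_const_zero]

theorem star_transfer [StarModule ℝ A] : star (transfer s d z w) = transfer s d w z := by
  simp only [transfer, star_sum, star_smul, star_mul, star_star, star_trivial]

theorem conjugate_transfer [StarModule ℝ A] (hx : ∀ i ∈ s, x * w i = z i) :
    x * transfer s d w w * star x = transfer s d z z := by
  rw [mul_transfer hx, ← star_transfer, ← star_mul, mul_transfer hx, star_transfer]

variable [PartialOrder A] [StarOrderedRing A] [IsOrderedModule ℝ A]

theorem transfer_self_nonneg (hd : ∀ i ∈ s, 0 ≤ d i) : 0 ≤ transfer s d w w :=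
  Finset.sum_nonneg fun i hi => smul_nonneg (hd i hi) (mul_star_self_nonneg _)

theorem transfer_self_mono {d' : ι → ℝ} (hd : ∀ i ∈ s, d i ≤ d' i) :
    transfer s d w w ≤ transfer s d' w w :=
  Finset.sum_le_sum fun i hi => smul_le_smul_of_nonneg_right (hd i hi) (mul_star_self_nonneg _)

end Transfer

namespace IsOrthogonalCopies

section Algebra

variable {ι A : Type*} [Semiring A] [StarRing A] {r t : A} {w : ι → A}

theorem mul_right (hw : IsOrthogonalCopies r w) {x : A} (ht : IsStarProjection t)
    (hx : star x * r * x = t) : IsOrthogonalCopies t (fun i => w i * x) where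
  isStarProjection := ht
  star_mul_self i := by
    rw [star_mul, mul_assoc, ← mul_assoc _ _ x, hw.star_mul_self, ← mul_assoc, hx]
  star_mul_of_ne i j hij := by
    rw [star_mul, mul_assoc, ← mul_assoc _ _ x, hw.star_mul_of_ne hij, zero_mul, mul_zero]

theorem of_pow_mul {s b : A} (hr : IsStarProjection r) (hb : star b * b = r)
    (hss : star s * s * s = s) (hsb : star s * s * b = b) (horth : star s * b = 0) :
    IsOrthogonalCopies r (fun i : ℕ => s ^ i * b) := by
  have hcancel (i : ℕ) : star s * (s ^ (i + 1) * b) = s ^ i * b := by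
    cases i with
    | zero => rw [pow_one, ← mul_assoc, hsb, pow_zero, one_mul]
    | succ i => simp only [pow_succ', ← mul_assoc, hss]
  have hshift (i : ℕ) (x : A) :
      star (s ^ (i + 1) * b) * x = star (s ^ i * b) * (star s * x) := by
    simp only [pow_succ', star_mul, mul_assoc]
  have horth' : star b * s = 0 := by simpa using congr(star $horth)
  refine ⟨hr, fun i => ?_, fun i => ?_⟩
  · induction i with
    | zero => simpa using hb
    | succ i ih => rw [hshift, hcancel, ih]
  · induction i with
    | zero =>
      rintro (_ | j) hij
      · exact absurd rfl hij
      · simp only [pow_zero, one_mul, pow_succ', ← mul_assoc, horth', zero_mul]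
    | succ i ih =>
      rintro (_ | j) hij
      · rw [hshift, pow_zero, one_mul, horth, mul_zero]
      · rw [hshift, hcancel, ih (by simpa using hij)]

end Algebra

section CStarRing

variable {ι A : Type*} [NormedRing A] [StarRing A] [CStarRing A] {r : A} {z w : ι → A}

theorem mul_source (hw : IsOrthogonalCopies r w) (i : ι) : w i * r = w i :=
  mul_eq_self_of_star_mul_self_eq hw.isStarProjection (hw.star_mul_self i)

variable [Algebra ℝ A]

theorem transfer_mul (hz : IsOrthogonalCopies r z) (hw : IsOrthogonalCopies r w) {s : Finset ι}
    {i : ι} (hi : i ∈ s) (d : ι → ℝ) : transfer s d z w * w i = d i • z i := by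
  rw [transfer, Finset.sum_mul, Finset.sum_eq_single_of_mem i hi fun j _ hji => by
    rw [smul_mul_assoc, mul_assoc, hw.star_mul_of_ne hji, mul_zero, smul_zero]]
  rw [smul_mul_assoc, mul_assoc, hw.star_mul_self, hz.mul_source]

theorem transfer_one_mul (hz : IsOrthogonalCopies r z) (hw : IsOrthogonalCopies r w)
    {s : Finset ι} : ∀ i ∈ s, transfer s 1 z w * w i = z i := fun i hi => by
  rw [hz.transfer_mul hw hi, Pi.one_apply, one_smul]

theorem isStarProjection_transfer [StarModule ℝ A] (hw : IsOrthogonalCopies r w) (s : Finset ι) :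
    IsStarProjection (transfer s 1 w w) where
  isIdempotentElem := mul_transfer (hw.transfer_one_mul hw)
  isSelfAdjoint := star_transfer

end CStarRing

end IsOrthogonalCopies

section Simple

variable {A : Type*} [CStarAlgebra A]

theorem IsSimpleCStar.eq_top_of_ne_bot (hA : IsSimpleCStar A) {I : TwoSidedIdeal A} (hI : I ≠ ⊥) :
    I = ⊤ := by
  have : I.asIdeal.closure.IsTwoSided :=
    ⟨fun {a} b ha => map_mem_closure (f := (· * b)) (continuous_mul_const b) ha
      fun x hx => I.mul_mem_right x b hx⟩
  have hcoe : (I.asIdeal.closure.toTwoSided : Set A) = closure I := by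
    ext; simp
  have hle : I ≤ I.asIdeal.closure.toTwoSided := fun x hx => by
    rw [← SetLike.mem_coe, hcoe]
    exact subset_closure hx
  have htop : I.asIdeal.closure.toTwoSided = ⊤ :=
    (hA.2 _ (hcoe ▸ isClosed_closure)).resolve_left fun h => hI (le_bot_iff.1 (h ▸ hle))
  by_contra hne
  have h1 : I.asIdeal ≠ ⊤ := fun h => hne <| by
    rw [← I.one_mem_iff]
    simpa using (Ideal.eq_top_iff_one _).1 h
  refine Ideal.closure_ne_top _ h1 ((Ideal.eq_top_iff_one _).2 ?_)
  have : (1 : A) ∈ I.asIdeal.closure.toTwoSided := htop ▸ trivial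
  simpa using this

theorem IsSimpleCStar.one_mem_span (hA : IsSimpleCStar A) {g : A} (hg : g ≠ 0) :
    (1 : A) ∈ TwoSidedIdeal.span {g} := by
  have hg' : g ∈ TwoSidedIdeal.span {g} := TwoSidedIdeal.subset_span rfl
  have htop : TwoSidedIdeal.span {g} = ⊤ := hA.eq_top_of_ne_bot fun h => hg <| by
    rwa [h, TwoSidedIdeal.mem_bot] at hg'
  exact htop ▸ TwoSidedIdeal.mem_top _

/-- The cone of finite sums of conjugates `x⋆ g x`; for `g ≥ 0` in a simple algebra it reaches the
unit, which is how simplicity enters the construction of isometries. -/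
def conjugateCone (g : A) : AddSubmonoid A :=
  AddSubmonoid.closure (Set.range fun x => star x * g * x)

theorem conjugate_mem_conjugateCone {g h : A} (hh : h ∈ conjugateCone g) (k : A) :
    star k * h * k ∈ conjugateCone g := by
  induction hh using AddSubmonoid.closure_induction with
  | mem _ h =>
    obtain ⟨x, rfl⟩ := h
    exact AddSubmonoid.subset_closure ⟨x * k, by simp only [star_mul, mul_assoc]⟩
  | zero => simp
  | add a b _ _ h h' =>
    rw [mul_add, add_mul]
    exact add_mem h h'

theorem exists_sum_conjugate_eq_of_mem_conjugateCone {g h : A} (hh : h ∈ conjugateCone g) :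
    ∃ (n : ℕ) (x : ℕ → A), ∑ i ∈ Finset.range n, star (x i) * g * x i = h := by
  induction hh using AddSubmonoid.closure_induction_left with
  | zero => exact ⟨0, 0, Finset.sum_range_zero _⟩
  | add_left _ h a _ ih =>
    obtain ⟨y, rfl⟩ := h
    obtain ⟨n, x, rfl⟩ := ih
    exact ⟨n + 1, fun i => Nat.casesOn i y x, Finset.sum_range_succ' _ n |>.trans (add_comm _ _)⟩

variable [PartialOrder A] [StarOrderedRing A]

theorem mul_mul_add_star_le {g : A} (hg : 0 ≤ g) (a b : A) :
    a * g * b + star (a * g * b) ≤ a * g * star a + star b * g * b := by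
  rw [← sub_nonneg]
  convert star_left_conjugate_nonneg hg (star a - b) using 1
  simp only [star_mul, star_sub, star_star, (IsSelfAdjoint.of_nonneg hg).star_eq]
  noncomm_ring

theorem exists_mem_conjugateCone_ge {g z : A} (hg : 0 ≤ g) (hz : z ∈ TwoSidedIdeal.span {g}) :
    ∃ h ∈ conjugateCone g, z + star z ≤ h := by
  have hgen (a b : A) : ∃ h ∈ conjugateCone g, a * g * b + star (a * g * b) ≤ h :=
    ⟨a * g * star a + star b * g * b,
      add_mem (AddSubmonoid.subset_closure ⟨star a, by simp⟩)
        (AddSubmonoid.subset_closure ⟨b, rfl⟩),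
      mul_mul_add_star_le hg a b⟩
  rw [TwoSidedIdeal.mem_span_iff_mem_addSubgroup_closure] at hz
  induction hz using AddSubgroup.closure_induction'' with
  | mem z hz =>
    obtain ⟨_, ⟨a, -, _, rfl, rfl⟩, b, -, rfl⟩ := hz
    exact hgen a b
  | neg_mem z hz =>
    obtain ⟨_, ⟨a, -, _, rfl, rfl⟩, b, -, rfl⟩ := hz
    simpa only [mul_neg] using hgen a (-b)
  | zero => exact ⟨0, zero_mem _, by simp⟩
  | add z z' _ _ h h' =>
    obtain ⟨k, hk, hzk⟩ := h
    obtain ⟨k', hk', hzk'⟩ := h'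
    refine ⟨k + k', add_mem hk hk', ?_⟩
    rw [star_add, add_add_add_comm]
    exact add_le_add hzk hzk'

theorem IsSimpleCStar.exists_sum_conjugate_eq_one (hA : IsSimpleCStar A) {g : A} (hg : 0 ≤ g)
    (hg0 : g ≠ 0) : ∃ (n : ℕ) (x : ℕ → A), ∑ i ∈ Finset.range n, star (x i) * g * x i = 1 := by
  obtain ⟨h, hh, hle⟩ := exists_mem_conjugateCone_ge hg (hA.one_mem_span hg0)
  have h1 : 1 ≤ h := le_trans (by simp) hle
  have hpos : IsStrictlyPositive h := .of_le isStrictlyPositive_one h1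
  refine exists_sum_conjugate_eq_of_mem_conjugateCone ?_
  have hmem := conjugate_mem_conjugateCone hh (h ^ (-(1 / 2) : ℝ))
  rwa [(IsSelfAdjoint.of_nonneg CFC.rpow_nonneg).star_eq,
    CFC.conjugate_rpow_neg_one_half h hpos] at hmem

theorem IsOrthogonalCopies.exists_isometry (hA : IsSimpleCStar A) {e g : A} {w : ℕ → A}
    (hw : IsOrthogonalCopies g w) (hg0 : g ≠ 0) (hew : ∀ i, e * w i = w i) :
    ∃ t : A, star t * t = 1 ∧ e * t = t := by
  obtain ⟨n, x, hx⟩ := hA.exists_sum_conjugate_eq_one hw.isStarProjection.nonneg hg0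
  refine ⟨∑ i ∈ Finset.range n, w i * x i, ?_, ?_⟩
  · rw [star_sum, Finset.sum_mul_sum, ← hx]
    refine Finset.sum_congr rfl fun i hi => ?_
    rw [Finset.sum_eq_single_of_mem i hi fun j _ hji => by
      rw [star_mul, mul_assoc, ← mul_assoc _ (w j), hw.star_mul_of_ne hji.symm, zero_mul, mul_zero]]
    rw [star_mul, mul_assoc, ← mul_assoc _ (w i), hw.star_mul_self, mul_assoc]
  · simp only [Finset.mul_sum, ← mul_assoc, hew]

end Simple

section PurelyInfinite

/-- The corner `q A q` cut out by a projection `q`. -/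
def cornerSubalgebra {A : Type*} [NonUnitalCStarAlgebra A] (q : A) (hq : IsStarProjection q) :
    NonUnitalStarSubalgebra ℂ A where
  carrier := {a | q * a = a ∧ a * q = a}
  add_mem' := fun ⟨hqa, haq⟩ ⟨hqb, hbq⟩ => ⟨by rw [mul_add, hqa, hqb], by rw [add_mul, haq, hbq]⟩
  zero_mem' := ⟨mul_zero q, zero_mul q⟩
  mul_mem' := fun ⟨hqa, _⟩ ⟨_, hbq⟩ => ⟨by rw [← mul_assoc, hqa], by rw [mul_assoc, hbq]⟩
  smul_mem' := fun c _ ⟨hqa, haq⟩ => ⟨by rw [mul_smul_comm, hqa], by rw [smul_mul_assoc, haq]⟩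
  star_mem' := fun {a} ⟨hqa, haq⟩ =>
    ⟨by simpa [hq.isSelfAdjoint.star_eq] using congr(star $haq),
      by simpa [hq.isSelfAdjoint.star_eq] using congr(star $hqa)⟩

theorem isHereditaryCStarSubalgebra_cornerSubalgebra {A : Type*} [NonUnitalCStarAlgebra A]
    [PartialOrder A] [StarOrderedRing A] {q : A} (hq : IsStarProjection q) :
    IsHereditaryCStarSubalgebra (cornerSubalgebra q hq) where
  isClosed := (isClosed_eq (continuous_const_mul q) continuous_id).inter
    (isClosed_eq (continuous_mul_const q) continuous_id)
  mem_of_le a b ha hab hb := by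
    have hb0 : 0 ≤ b := ha.trans hab
    have hbq : b ≤ ‖b‖ • q := by
      have h := CStarAlgebra.star_left_conjugate_le_norm_smul (a := q) (b := b)
      rwa [hq.isSelfAdjoint.star_eq, hb.1, hb.2, hq.isIdempotentElem.eq] at h
    have hc : 0 < ‖b‖ + 1 := by positivity
    have hle : (‖b‖ + 1)⁻¹ • a ≤ q := by
      rw [inv_smul_le_iff_of_pos hc]
      refine (hab.trans hbq).trans (smul_le_smul_of_nonneg_right ?_ hq.nonneg)
      exact le_add_of_nonneg_right zero_le_one
    have hmem := hq.mul_right_and_mul_left_of_nonneg_of_le (smul_nonneg (inv_nonneg.2 hc.le) ha) hle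
    have hinj := smul_right_injective A (inv_ne_zero hc.ne')
    exact ⟨hinj (by simpa only [mul_smul_comm] using hmem.2),
      hinj (by simpa only [smul_mul_assoc] using hmem.1)⟩

theorem IsPurelyInfiniteCStar.exists_isInfiniteProjection_mul_eq {A : Type*}
    [NonUnitalCStarAlgebra A] [PartialOrder A] [StarOrderedRing A] (hA : IsPurelyInfiniteCStar A)
    {q : A} (hq : IsStarProjection q) (hq0 : q ≠ 0) : ∃ e, IsInfiniteProjection e ∧ q * e = e := by
  have hmem : q ∈ cornerSubalgebra q hq := ⟨hq.isIdempotentElem.eq, hq.isIdempotentElem.eq⟩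
  obtain ⟨e, he, hinf⟩ := hA _ (isHereditaryCStarSubalgebra_cornerSubalgebra hq) fun h => hq0 <| by
    rwa [h, NonUnitalStarAlgebra.mem_bot] at hmem
  exact ⟨e, hinf, he.1⟩

variable {A : Type*} [CStarAlgebra A] [PartialOrder A] [StarOrderedRing A]

theorem IsInfiniteProjection.exists_isOrthogonalCopies {e : A} (he : IsInfiniteProjection e) :
    ∃ (g : A) (w : ℕ → A), g ≠ 0 ∧ IsOrthogonalCopies g w ∧ ∀ i, e * w i = w i := by
  obtain ⟨hep, s, hs, hle, hne⟩ := he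
  have hsp := isStarProjection_mul_star_self hep hs
  have hse : s * e = s := mul_eq_self_of_star_mul_self_eq hep hs
  have hes : e * s = s := by
    calc e * s = e * (s * star s) * s := by rw [mul_assoc, mul_assoc, hs, hse]
      _ = s := by rw [(hsp.le_iff_mul_eq_right hep).1 hle, mul_assoc, hs, hse]
  have hg : IsStarProjection (e - s * star s) := (hsp.le_iff_sub hep).1 hle
  have heg : e * (e - s * star s) = e - s * star s := by
    rw [mul_sub, hep.isIdempotentElem.eq, ← mul_assoc, hes]
  have hsg : star s * (e - s * star s) = 0 := by
    have hse_star : e * star s = star s := by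
      simpa [hep.isSelfAdjoint.star_eq] using congr(star $hse)
    have hes_star : star s * e = star s := by
      simpa [hep.isSelfAdjoint.star_eq] using congr(star $hes)
    rw [mul_sub, hes_star, ← mul_assoc, hs, hse_star, sub_self]
  refine ⟨e - s * star s, fun i => s ^ i * (e - s * star s), sub_ne_zero.2 hne.symm,
    .of_pow_mul hg ?_ ?_ ?_ hsg, ?_⟩
  · rw [hg.isSelfAdjoint.star_eq, hg.isIdempotentElem.eq]
  · rw [hs, hes]
  · rw [hs, heg]
  · rintro (_ | i)
    · simpa using heg
    · simp only [pow_succ', ← mul_assoc, hes]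

theorem IsPurelyInfiniteCStar.exists_isometry (hA : IsPurelyInfiniteCStar A)
    (hs : IsSimpleCStar A) {q : A} (hq : IsStarProjection q) (hq0 : q ≠ 0) :
    ∃ t : A, star t * t = 1 ∧ q * t = t := by
  obtain ⟨e, he, hqe⟩ := hA.exists_isInfiniteProjection_mul_eq hq hq0
  obtain ⟨g, w, hg0, hw, hew⟩ := he.exists_isOrthogonalCopies
  exact hw.exists_isometry hs hg0 fun i => by rw [← hew, ← mul_assoc, hqe]

theorem IsPurelyInfiniteCStar.exists_isOrthogonalCopies (hA : IsPurelyInfiniteCStar A)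
    (hs : IsSimpleCStar A) {q r : A} (hq : IsStarProjection q) (hq0 : q ≠ 0)
    (hr : IsStarProjection r) : ∃ w : ℕ → A, IsOrthogonalCopies r w ∧ ∀ i, q * w i = w i := by
  obtain ⟨e, he, hqe⟩ := hA.exists_isInfiniteProjection_mul_eq hq hq0
  obtain ⟨g, w, hg0, hw, hew⟩ := he.exists_isOrthogonalCopies
  obtain ⟨t, ht, hgt⟩ := hA.exists_isometry hs hw.isStarProjection hg0
  have hqw (i : ℕ) : q * w i = w i := by rw [← hew, ← mul_assoc, hqe]
  refine ⟨fun i => w i * (t * r), hw.mul_right hr ?_, fun i => by rw [← mul_assoc, hqw]⟩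
  calc star (t * r) * g * (t * r) = star r * (star t * (g * t)) * r := by
        rw [star_mul]; noncomm_ring
    _ = r := by rw [hgt, ht, mul_one, hr.isSelfAdjoint.star_eq, hr.isIdempotentElem.eq]

end PurelyInfinite

section Tower

variable {A : Type*}

/-- The positive element `½ (1 + x) c (1 + x)⋆`; under `IsTowerDatum p x c` it is the base of a
Rokhlin tower of height two for conjugation by `1 - 2 * p`. -/
noncomputable def towerBase [Ring A] [StarRing A] [Algebra ℝ A] (x c : A) : A :=
  (1 / 2 : ℝ) • ((1 + x) * c * star (1 + x))

/-- The element `c ≥ 0` lives under `1 - p`, and `x` carries the support of `c` isometrically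
under `p`. -/
structure IsTowerDatum [Ring A] [StarRing A] [PartialOrder A] (p x c : A) : Prop where
  nonneg : 0 ≤ c
  mul_eq_zero : p * c = 0
  mul_eq_self : p * x = x
  star_mul_self_mul : star x * x * c = c

theorem towerBase_add_towerBase_neg [Ring A] [StarRing A] [Algebra ℝ A] (x c : A) :
    towerBase x c + towerBase (-x) c = c + x * c * star x := by
  have h : (1 + x) * c * star (1 + x) + (1 + -x) * c * star (1 + -x) =
      (2 : ℝ) • (c + x * c * star x) := by
    rw [two_smul, star_add, star_add, star_neg, star_one]
    noncomm_ring
  rw [towerBase, towerBase, ← smul_add, h, smul_smul, one_div, inv_mul_cancel₀ two_ne_zero,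
    one_smul]

theorem towerBase_nonneg [Ring A] [StarRing A] [Algebra ℝ A] [PartialOrder A] [StarOrderedRing A]
    [IsOrderedModule ℝ A] {c : A} (hc : 0 ≤ c) (x : A) : 0 ≤ towerBase x c :=
  smul_nonneg (by norm_num) (star_right_conjugate_nonneg hc _)

namespace IsTowerDatum

variable [Ring A] [StarRing A] [Algebra ℝ A] [PartialOrder A] [StarOrderedRing A] {p x c : A}

theorem conjugate_towerBase (h : IsTowerDatum p x c) :
    (1 - 2 * p) * towerBase x c * star (1 - 2 * p) = towerBase (-x) c := by
  have hflip : (1 - 2 * p) * (1 + x) * c = (1 + -x) * c := by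
    calc (1 - 2 * p) * (1 + x) * c = c + x * c - 2 * (p * c) - 2 * (p * x * c) := by noncomm_ring
      _ = (1 + -x) * c := by rw [h.mul_eq_zero, h.mul_eq_self]; noncomm_ring
  have hflip_star : c * star (1 + x) * star (1 - 2 * p) = c * star (1 + -x) := by
    simpa only [star_mul, (IsSelfAdjoint.of_nonneg h.nonneg).star_eq, mul_assoc]
      using congr(star $hflip)
  rw [towerBase, towerBase, mul_smul_comm, smul_mul_assoc, ← hflip, mul_assoc (_ * _) c,
    ← hflip_star]
  simp only [mul_assoc]

theorem towerBase_mul_towerBase_neg (h : IsTowerDatum p x c) (hp : IsSelfAdjoint p) :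
    towerBase x c * towerBase (-x) c = 0 := by
  have hcx : c * x = 0 := by
    have hcp : c * p = 0 := by
      simpa [hp.star_eq, (IsSelfAdjoint.of_nonneg h.nonneg).star_eq]
        using congr(star $h.mul_eq_zero)
    rw [← h.mul_eq_self, ← mul_assoc, hcp, zero_mul]
  have hxc : star x * c = 0 := by
    simpa [(IsSelfAdjoint.of_nonneg h.nonneg).star_eq] using congr(star $hcx)
  have hmid : c * star (1 + x) * ((1 + -x) * c) = 0 := by
    calc c * star (1 + x) * ((1 + -x) * c)
        = c * c - c * x * c + c * (star x * c) - c * (star x * x * c) := by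
          rw [star_add, star_one]; noncomm_ring
      _ = 0 := by rw [hcx, hxc, h.star_mul_self_mul]; simp
  have : (1 + x) * c * star (1 + x) * ((1 + -x) * c * star (1 + -x)) =
      (1 + x) * (c * star (1 + x) * ((1 + -x) * c)) * star (1 + -x) := by
    simp only [mul_assoc]
  rw [towerBase, towerBase, smul_mul_smul_comm, this, hmid, mul_zero, zero_mul, smul_zero]

end IsTowerDatum

theorem exists_towers_of_isTowerDatum {ι : Type*} [Fintype ι] [CStarAlgebra A] [PartialOrder A]
    [StarOrderedRing A] {p : A} (hp : IsSelfAdjoint p) {x c : ι → A}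
    (h : ∀ i, IsTowerDatum p (x i) (c i)) (hle : ∑ i, (c i + x i * c i * star (x i)) ≤ 1) :
    ∃ f : ι → A, (∀ i, 0 ≤ f i ∧ ‖f i‖ ≤ 1) ∧
      (∀ i, f i * ((1 - 2 * p) * f i * star (1 - 2 * p)) = 0) ∧
      ∑ i, (f i + (1 - 2 * p) * f i * star (1 - 2 * p)) = ∑ i, (c i + x i * c i * star (x i)) := by
  have hf (i : ι) : 0 ≤ towerBase (x i) (c i) := towerBase_nonneg (h i).nonneg _
  have hf' (i : ι) : 0 ≤ towerBase (-x i) (c i) := towerBase_nonneg (h i).nonneg _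
  refine ⟨fun i => towerBase (x i) (c i), fun i => ⟨hf i, ?_⟩, fun i => ?_, ?_⟩
  · rw [CStarAlgebra.norm_le_one_iff_of_nonneg _ (hf i)]
    calc towerBase (x i) (c i)
        ≤ towerBase (x i) (c i) + towerBase (-x i) (c i) := le_add_of_nonneg_right (hf' i)
      _ ≤ ∑ j, (towerBase (x j) (c j) + towerBase (-x j) (c j)) :=
        Finset.single_le_sum (fun j _ => add_nonneg (hf j) (hf' j)) (Finset.mem_univ i)
      _ ≤ 1 := by simpa only [towerBase_add_towerBase_neg] using hle
  · rw [(h i).conjugate_towerBase, (h i).towerBase_mul_towerBase_neg hp]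
  · simp only [(h _).conjugate_towerBase, towerBase_add_towerBase_neg]

end Tower

section SummationByParts

variable {K E : Type*} [Field K] [AddCommGroup E] [Module K E] (Z : ℕ → E)

theorem sum_range_natCast_sub_smul_sub (n : ℕ) :
    ∑ i ∈ Finset.range n, ((n : K) - (i + 1)) • (Z i - Z (i + 1)) =
      (n : K) • Z 0 - ∑ i ∈ Finset.range n, Z i := by
  induction n with
  | zero => simp
  | succ n ih =>
    have hweight (i : ℕ) : (((n + 1 : ℕ) : K) - (i + 1)) • (Z i - Z (i + 1)) =
        ((n : K) - (i + 1)) • (Z i - Z (i + 1)) + (Z i - Z (i + 1)) := by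
      push_cast
      module
    rw [Finset.sum_congr rfl fun i _ => hweight i, Finset.sum_add_distrib, Finset.sum_range_sub',
      Finset.sum_range_succ, ih, Finset.sum_range_succ]
    push_cast
    module

theorem sum_range_one_sub_div_smul_sub [CharZero K] {n : ℕ} (hn : n ≠ 0) :
    ∑ i ∈ Finset.range n, (1 - (i + 1) / n : K) • (Z i - Z (i + 1)) =
      Z 0 - (n : K)⁻¹ • ∑ i ∈ Finset.range n, Z i := by
  have hn' : (n : K) ≠ 0 := Nat.cast_ne_zero.2 hn
  calc ∑ i ∈ Finset.range n, (1 - (i + 1) / n : K) • (Z i - Z (i + 1))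
      = (n : K)⁻¹ • ∑ i ∈ Finset.range n, ((n : K) - (i + 1)) • (Z i - Z (i + 1)) := by
        rw [Finset.smul_sum]
        refine Finset.sum_congr rfl fun i _ => ?_
        rw [smul_smul]
        congr 1
        field_simp
    _ = Z 0 - (n : K)⁻¹ • ∑ i ∈ Finset.range n, Z i := by
        rw [sum_range_natCast_sub_smul_sub, smul_sub, inv_smul_smul₀ hn']

end SummationByParts

section TwoTowers

/-- The weight `1 - (i + 1) / n` with which the second tower takes over the `i`-th of `n`
copies; consecutive weights differ by `1 / n`. -/
noncomputable def towerWeight (n i : ℕ) : ℝ := 1 - (i + 1) / n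

theorem towerWeight_nonneg {n i : ℕ} (hi : i < n) : 0 ≤ towerWeight n i :=
  sub_nonneg.2 (div_le_one_of_le₀ (mod_cast hi) n.cast_nonneg)

theorem towerWeight_le_one (n i : ℕ) : towerWeight n i ≤ 1 :=
  sub_le_self _ (by positivity)

theorem transfer_towerWeight_sub_transfer_succ {A : Type*} [Ring A] [StarRing A] [Algebra ℝ A]
    (z : ℕ → A) {n : ℕ} (hn : n ≠ 0) :
    transfer (.range n) (towerWeight n) z z -
        transfer (.range n) (towerWeight n) (fun i => z (i + 1)) (fun i => z (i + 1)) =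
      z 0 * star (z 0) - (n : ℝ)⁻¹ • transfer (.range n) 1 z z := by
  simpa only [transfer, towerWeight, smul_sub, Finset.sum_sub_distrib, Pi.one_apply, one_smul]
    using sum_range_one_sub_div_smul_sub (K := ℝ) (fun i => z i * star (z i)) hn

theorem sum_towers_eq {A : Type*} [Ring A] [StarRing A] [Algebra ℝ A] [StarModule ℝ A]
    {p v x : A} {z w : ℕ → A} (hvp : v * (1 - p) = v) (hz0 : z 0 * star (z 0) = p - v * star v)
    (hvw : ∀ i, v * w i = z (i + 1)) {n : ℕ} (hxw : ∀ i ∈ Finset.range n, x * w i = z i)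
    (hn : n ≠ 0) :
    1 - p - transfer (.range n) (towerWeight n) w w +
          v * (1 - p - transfer (.range n) (towerWeight n) w w) * star v +
        (transfer (.range n) (towerWeight n) w w +
          x * transfer (.range n) (towerWeight n) w w * star x) =
      1 - (n : ℝ)⁻¹ • transfer (.range n) 1 z z := by
  have hjumps := transfer_towerWeight_sub_transfer_succ z hn
  rw [hz0, sub_eq_iff_eq_add] at hjumps
  rw [mul_sub, sub_mul, hvp, conjugate_transfer fun i _ => hvw i, conjugate_transfer hxw, hjumps]
  abel

/-- The family `r, v w₀, v w₁, …`: the copies `w i` moved by `v`, preceded by `r` itself. -/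
def shiftedCopies {A : Type*} [Mul A] (r v : A) (w : ℕ → A) : ℕ → A
  | 0 => r
  | i + 1 => v * w i

theorem isOrthogonalCopies_shiftedCopies {A : Type*} [Semiring A] [StarRing A] {r v : A}
    {w : ℕ → A} (hw : IsOrthogonalCopies r w) (hvw : ∀ i, star v * v * w i = w i)
    (hvr : star v * r = 0) : IsOrthogonalCopies r (shiftedCopies r v w) := by
  have hmul (i j : ℕ) : star (v * w i) * (v * w j) = star (w i) * w j := by
    rw [star_mul, mul_assoc, ← mul_assoc (star v), hvw]
  have hrv : star r * v = 0 := by simpa using congr(star $hvr)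
  refine ⟨hw.isStarProjection, ?_, ?_⟩
  · rintro (_ | i)
    · exact hw.isStarProjection.isSelfAdjoint.star_eq.symm ▸ hw.isStarProjection.isIdempotentElem.eq
    · exact (hmul i i).trans (hw.star_mul_self i)
  · rintro (_ | i) (_ | j) hij
    · exact absurd rfl hij
    · simp only [shiftedCopies, ← mul_assoc, hrv, zero_mul]
    · simp only [shiftedCopies, star_mul, mul_assoc, hvr, mul_zero]
    · exact (hmul i j).trans (hw.star_mul_of_ne (by simpa using hij))

variable {A : Type*} [CStarAlgebra A] [PartialOrder A] [StarOrderedRing A]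

theorem IsOrthogonalCopies.isTowerDatum_transfer {ι : Type*} {p r : A} {z w : ι → A}
    (hz : IsOrthogonalCopies r z) (hw : IsOrthogonalCopies r w) (hpz : ∀ i, p * z i = z i)
    (hpw : ∀ i, p * w i = 0) {s : Finset ι} {d : ι → ℝ} (hd : ∀ i ∈ s, 0 ≤ d i) :
    IsTowerDatum p (transfer s 1 z w) (transfer s d w w) where
  nonneg := transfer_self_nonneg hd
  mul_eq_zero := mul_transfer_eq_zero hpw
  mul_eq_self := mul_transfer fun i _ => hpz i
  star_mul_self_mul := mul_transfer fun i hi => by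
    rw [star_transfer, mul_assoc, hz.transfer_one_mul hw i hi, hw.transfer_one_mul hz i hi]

theorem isTowerDatum_one_sub_sub_transfer {ι : Type*} {p v r : A} {w : ι → A}
    (hp : IsStarProjection p) (hvv : star v * v = 1 - p) (hpv : p * v = v)
    (hw : IsOrthogonalCopies r w) (hpw : ∀ i, p * w i = 0) {s : Finset ι} {d : ι → ℝ}
    (hd : ∀ i ∈ s, d i ≤ 1) : IsTowerDatum p v (1 - p - transfer s d w w) := by
  have hmul : p * (1 - p - transfer s d w w) = 0 := by
    rw [mul_sub, mul_sub, mul_one, hp.isIdempotentElem.eq, mul_transfer_eq_zero hpw, sub_self,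
      sub_zero]
  refine ⟨sub_nonneg.2 ?_, hmul, hpv, by rw [hvv, sub_mul, hmul, one_mul, sub_zero]⟩
  calc transfer s d w w
      ≤ transfer s 1 w w := transfer_self_mono hd
    _ ≤ 1 - p := ((hw.isStarProjection_transfer s).le_iff_mul_eq_right hp.one_sub).2 <| by
      rw [sub_mul, one_mul, mul_transfer_eq_zero hpw, sub_zero]

theorem exists_isTowerDatum_sum_eq {p v : A} (hp : IsStarProjection p)
    (hvv : star v * v = 1 - p) (hpv : p * v = v) {w : ℕ → A}
    (hw : IsOrthogonalCopies (p - v * star v) w) (hpw : ∀ i, p * w i = 0) {n : ℕ} (hn : n ≠ 0) :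
    ∃ x c : Fin 2 → A, (∀ i, IsTowerDatum p (x i) (c i)) ∧ ∃ e : A, IsStarProjection e ∧
      ∑ i, (c i + x i * c i * star (x i)) = 1 - (n : ℝ)⁻¹ • e := by
  set r := p - v * star v with hr
  have hvq : v * (1 - p) = v := mul_eq_self_of_star_mul_self_eq hp.one_sub hvv
  have hpr : p * r = r := by rw [hr, mul_sub, hp.isIdempotentElem.eq, ← mul_assoc, hpv]
  have hvr : star v * r = 0 := by
    have hrv : r * v = 0 := by rw [hr, sub_mul, hpv, mul_assoc, hvv, hvq, sub_self]
    simpa [hw.isStarProjection.isSelfAdjoint.star_eq] using congr(star $hrv)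
  let z := shiftedCopies r v w
  have hz : IsOrthogonalCopies r z := isOrthogonalCopies_shiftedCopies hw
    (fun i => by rw [hvv, sub_mul, hpw, one_mul, sub_zero]) hvr
  have hpz : ∀ i, p * z i = z i
    | 0 => hpr
    | i + 1 => by simp only [z, shiftedCopies, ← mul_assoc, hpv]
  have hz0 : z 0 * star (z 0) = r := by
    rw [show z 0 = r from rfl, hw.isStarProjection.isSelfAdjoint.star_eq,
      hw.isStarProjection.isIdempotentElem.eq]
  let D := transfer (.range n) (towerWeight n) w w
  let T := transfer (.range n) 1 z w
  refine ⟨![v, T], ![1 - p - D, D], Fin.forall_fin_two.2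
    ⟨isTowerDatum_one_sub_sub_transfer hp hvv hpv hw hpw fun i _ => towerWeight_le_one n i,
      hz.isTowerDatum_transfer hw hpz hpw fun i hi => towerWeight_nonneg (Finset.mem_range.1 hi)⟩,
    transfer (.range n) 1 z z, hz.isStarProjection_transfer (.range n), ?_⟩
  simpa only [Fin.sum_univ_two, Matrix.cons_val_zero, Matrix.cons_val_one] using
    sum_towers_eq hvq hz0 (fun _ => rfl) (hz.transfer_one_mul hw) hn

theorem exists_towers {p v : A} (hp : IsStarProjection p)
    (hvv : star v * v = 1 - p) (hpv : p * v = v) {w : ℕ → A}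
    (hw : IsOrthogonalCopies (p - v * star v) w) (hpw : ∀ i, p * w i = 0) {n : ℕ} (hn : n ≠ 0) :
    ∃ f : Fin 2 → A, (∀ i, 0 ≤ f i ∧ ‖f i‖ ≤ 1) ∧
      (∀ i, f i * ((1 - 2 * p) * f i * star (1 - 2 * p)) = 0) ∧
      ‖∑ i, (f i + (1 - 2 * p) * f i * star (1 - 2 * p)) - 1‖ ≤ (n : ℝ)⁻¹ := by
  obtain ⟨x, c, h, e, he, hsum⟩ := exists_isTowerDatum_sum_eq hp hvv hpv hw hpw hn
  have hle : ∑ i, (c i + x i * c i * star (x i)) ≤ 1 :=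
    hsum.trans_le (sub_le_self _ (smul_nonneg (by positivity) he.nonneg))
  obtain ⟨f, hf, horth, hf_sum⟩ := exists_towers_of_isTowerDatum hp.isSelfAdjoint h hle
  refine ⟨f, hf, horth, ?_⟩
  rw [hf_sum, hsum, sub_sub_cancel_left, norm_neg, norm_smul, Real.norm_of_nonneg (by positivity)]
  exact mul_le_of_le_one_right (by positivity) (IsStarProjection.norm_le _ he)

end TwoTowers

theorem lemma2p1_general {A : Type*} [CStarAlgebra A] [PartialOrder A] [StarOrderedRing A]
    (hs : IsSimpleCStar A) (hA : IsPurelyInfiniteCStar A) (p : A) (hp : IsStarProjection p)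
    (hp0 : p ≠ 0) (hp1 : p ≠ 1) (u : A) (hu : u = 1 - 2 * p) (ε : ℝ) (hε : 0 < ε) :
    ∃ f : Fin 2 → A,
      (∀ i, 0 ≤ f i ∧ ‖f i‖ ≤ 1) ∧
      (∀ i, f i * (u * f i * star u) = 0) ∧
      ‖(∑ i, (f i + u * f i * star u)) - 1‖ ≤ ε := by
  subst hu
  have hq : IsStarProjection (1 - p) := hp.one_sub
  obtain ⟨n, hn, hnε⟩ := Real.exists_nat_pos_inv_lt hε
  obtain ⟨v, hv, hpv⟩ := hA.exists_isOrthogonalCopies hs hp hp0 hq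
  have hdefect : IsStarProjection (p - v 0 * star (v 0)) :=
    (isStarProjection_mul_star_self hq (hv.star_mul_self 0)).sub_of_mul_eq_right hp
      (by rw [← mul_assoc, hpv])
  obtain ⟨w, hw, hqw⟩ := hA.exists_isOrthogonalCopies hs hq (sub_ne_zero.2 hp1.symm) hdefect
  have hpw (i : ℕ) : p * w i = 0 := by
    rw [← hqw, ← mul_assoc, hp.mul_one_sub_self, zero_mul]
  obtain ⟨f, hf, horth, hsum⟩ := exists_towers hp (hv.star_mul_self 0) (hpv 0) hw hpw hn.ne'
  exact ⟨f, hf, horth, hsum.trans hnε.le⟩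

theorem lemma2p1 {A : Type*} [CStarAlgebra A] [PartialOrder A] [StarOrderedRing A]
    (hA : IsKirchbergAlgebra A) (p : A) (hp : IsStarProjection p)
    (hp0 : p ≠ 0) (hp1 : p ≠ 1) (hK : kZeroClass p hp = 0)
    (u : A) (hu : u = 1 - 2 * p) (ε : ℝ) (hε : 0 < ε) :
    ∃ f : Fin 2 → A,
      (∀ i, 0 ≤ f i ∧ ‖f i‖ ≤ 1) ∧
      (∀ i, f i * (u * f i * star u) = 0) ∧
      ‖(∑ i, (f i + u * f i * star u)) - 1‖ ≤ ε := by
  exact lemma2p1_general hA.simple hA.purelyInfinite p hp hp0 hp1 u hu ε hε
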